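/- For each $n\ge 1$ let $(x_{ij})_{1\le i,j\le n}$ be i.i.d. real random variables (on a probability space that may depend on $n$) with the exponential distribution of mean $1$, let $\mathfrak P=(p_{ij})\in\mathbb R^{n\times n}$ with $p_{ij}=x_{ij}/\sum_{k=1}^n x_{ik}$ (so that the rows of $\mathfrak P$ are independent and flat-Dirichlet distributed), and let $W=\mathfrak P-I$, with singular values $s_1(W)\ge\dots\ge s_n(W)\ge 0$ counted with multiplicity. Here $n=|\mathcal S|$ is the number of states. Then: 1. for every $n\ge 1$, almost surely $s_n(W)=0$; 2. $|s_j(W)-1|\prec n^{-1/4}$ uniformly in $1\le j\le n-1$, that is, for all $\epsilon>0$ and $D>0$ there is $n_0=n_0(\epsilon,D)$ such that for all $n>n_0$ and all $1\le j\le n-1$, $$\mathbb P\bigl(|s_j(W)-1|>n^{\epsilon}\,n^{-1/4}\bigr)\le n^{-D};$$ 3. consequently $\mathrm{rank}(W)=n-1$ with high probability, that is, for every $D>0$ there is $n_0=n_0(D)$ such that $\mathbb P(\mathrm{rank}(W)=n-1)\ge 1-n^{-D}$ for all $n\ge n_0$. -/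

import Mathlib

open MeasureTheory ProbabilityTheory
open scoped ENNReal

noncomputable section

/-- The `j`-th largest singular value `s_j(A)`, for `1 ≤ j ≤ n`, of a real `n × n` matrix, counted
with multiplicity, so that `s_n(A) ≤ … ≤ s_1(A)`. (Mathlib's sequence starts at index `0`.) -/
def sv {n : ℕ} (A : Matrix (Fin n) (Fin n) ℝ) (j : ℕ) : ℝ :=
  (Matrix.toEuclideanLin A).singularValues (j - 1)

/-- Row normalization: `p i j = x i j / ∑ k, x i k`. -/
def rowNormalize {n : ℕ} (x : Fin n → Fin n → ℝ) : Matrix (Fin n) (Fin n) ℝ :=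
  Matrix.of fun i j => x i j / ∑ k, x i k

/-- The law of the array is that of i.i.d. exponential variables with expectation `1`. -/
structure IsIIDExpArray {n : ℕ} {Ω : Type*} [MeasurableSpace Ω] (μ : Measure Ω)
    (x : Fin n → Fin n → Ω → ℝ) : Prop where
  indep : iIndepFun (fun ij : Fin n × Fin n => x ij.1 ij.2) μ
  law : ∀ i j, HasLaw (x i j) (expMeasure 1) μ

/-- `X ≺ Y` uniformly in the parameter `v`, which may range over an `n`-dependent set `V n`:
the threshold `N` depends only on `ε` and `D`. -/
def StochDomUnif {Ω : ℕ → Type*} [∀ n, MeasurableSpace (Ω n)] (μ : ∀ n, Measure (Ω n))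
    {V : ℕ → Type*} (X Y : ∀ n, V n → Ω n → ℝ) : Prop :=
  ∀ ε : ℝ, 0 < ε → ∀ D : ℝ, 0 < D → ∃ N : ℕ, ∀ n : ℕ, N < n → ∀ v : V n,
    (μ n).real {ω | (n : ℝ) ^ ε * Y n v ω < X n v ω} ≤ (n : ℝ) ^ (-D)

/-- The events `E n` hold with high probability. -/
def WithHighProb {Ω : ℕ → Type*} [∀ n, MeasurableSpace (Ω n)] (μ : ∀ n, Measure (Ω n))
    (E : ∀ n, Set (Ω n)) : Prop :=
  ∀ D : ℝ, 0 < D → ∃ N : ℕ, ∀ n : ℕ, N ≤ n → 1 - (n : ℝ) ^ (-D) ≤ (μ n).real (E n)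

end

/-!
Let `J` be the all-ones matrix and `E = rowNormalize x - J / n`, so that
`W = rowNormalize x - 1 = E - (1 - J / n)`, where `1 - J / n` is the orthogonal projection to the
complement of the constant vectors. The constant vectors are in the kernel of `W`, and hence
`s_n(W) = 0`. On their complement `W` is `E - 1`, so an argument of Courant–Fischer type
(`abs_singularValues_sub_one_le`) shows that the other singular values are within `‖E‖` of `1`.
The statement about the rank follows once `‖E‖ < 1`.

To bound `‖E‖`, write `‖E‖² = ‖E Eᵀ‖` and use the Frobenius norm of the Gram matrix `E Eᵀ`
(`Matrix.l2_opNorm_sq_le_of_gram`). With `y = x - 1`, an entry of `E Eᵀ` is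
`(∑ k, y i k * y j k - (∑ k, y i k) * (∑ k, y j k) / n) / (S i * S j)`, where `S i` is the `i`-th
row sum of `x`. If the sums in the numerator have square-root cancellation, up to powers of `M`,
then the entries off the diagonal are of order `n ^ (-3/2)` and those on the diagonal of order
`n⁻¹`, so the Frobenius norm is of order `n ^ (-1/2)` and `‖E‖` is of order `n ^ (-1/4)`
(`IsRegularArray.norm_centredRowNormalize_le`).

Square-root cancellation is a Chernoff bound with parameter of order `n ^ (-1/2)`
(`IsIIDExpArray.measureReal_not_isRegularArray_le`). The products `y i k * y j k` have no
exponential moments, but they do after the first factor is cut off at `M`. The cutoff keeps the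
mean at zero, because the second factor is centred and independent of the first, and it changes
nothing unless some entry exceeds `M`. All failure probabilities are `O(n² exp (-M / 2))`, which
for `M = n ^ η` is smaller than any power of `n`.
-/

/-! ### Singular values of an operator close to an isometry on a hyperplane -/

open Module in
/-- `T` maps distinct right singular vectors to orthogonal vectors, so Pythagoras applies. -/
lemma norm_sq_apply_add_smul_eigenvectorBasis {E : Type*} [NormedAddCommGroup E]
    [InnerProductSpace ℝ E] [FiniteDimensional ℝ E] (T : E →ₗ[ℝ] E) {n : ℕ}
    (hn : finrank ℝ E = n) {i j : Fin n} (hij : i ≠ j) (a b : ℝ) :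
    ‖T (a • T.isSymmetric_adjoint_comp_self.eigenvectorBasis hn i +
      b • T.isSymmetric_adjoint_comp_self.eigenvectorBasis hn j)‖ ^ 2 =
      a ^ 2 * T.singularValues i ^ 2 + b ^ 2 * T.singularValues j ^ 2 := by
  set hT := T.isSymmetric_adjoint_comp_self
  set v := hT.eigenvectorBasis hn
  have key : ∀ p q, inner ℝ (T (v p)) (T (v q)) =
      hT.eigenvalues hn q * inner ℝ (v p) (v q) := by
    intro p q
    have := hT.apply_eigenvectorBasis hn q
    rw [← LinearMap.adjoint_inner_right, ← LinearMap.comp_apply, this, inner_smul_right]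
    rfl
  have o := orthonormal_iff_ite.mp v.orthonormal
  rw [T.sq_singularValues_fin hn, T.sq_singularValues_fin hn, ← real_inner_self_eq_norm_sq]
  simp only [map_add, map_smul, inner_add_left, inner_add_right, inner_smul_left,
    inner_smul_right, key, o, hij, hij.symm, if_true, if_false]
  simp
  ring

open Module in
/-- If `T` expands by at most `1 + δ`, and by at least `1 - δ` on the hyperplane orthogonal to `w`,
then all singular values of `T` except possibly the last are `δ`-close to `1`. -/
lemma abs_singularValues_sub_one_le {E : Type*} [NormedAddCommGroup E]
    [InnerProductSpace ℝ E] [FiniteDimensional ℝ E] (T : E →ₗ[ℝ] E) {δ : ℝ} (w : E)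
    (hup : ∀ v, ‖T v‖ ≤ (1 + δ) * ‖v‖)
    (hlow : ∀ v, inner ℝ w v = 0 → (1 - δ) * ‖v‖ ≤ ‖T v‖) {k : ℕ}
    (hk : k + 1 < finrank ℝ E) : |T.singularValues k - 1| ≤ δ := by
  set n := finrank ℝ E with hn
  set v := T.isSymmetric_adjoint_comp_self.eigenvectorBasis hn.symm
  set i : Fin n := ⟨k, by omega⟩
  set j : Fin n := ⟨k + 1, hk⟩
  have hij : i ≠ j := by simp [i, j, Fin.ext_iff]
  have H : ∀ a b : ℝ, ‖T (a • v i + b • v j)‖ ^ 2 =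
      a ^ 2 * T.singularValues k ^ 2 + b ^ 2 * T.singularValues (k + 1) ^ 2 := fun a b =>
    norm_sq_apply_add_smul_eigenvectorBasis T hn.symm hij a b
  have o := orthonormal_iff_ite.mp v.orthonormal
  have N : ∀ a b : ℝ, ‖a • v i + b • v j‖ ^ 2 = a ^ 2 + b ^ 2 := by
    intro a b
    rw [← real_inner_self_eq_norm_sq]
    simp only [inner_add_left, inner_add_right, inner_smul_left, inner_smul_right, o, hij,
      hij.symm, if_true, if_false]
    simp
    ring
  have s0 := T.singularValues_nonneg k
  have s1 := T.singularValues_nonneg (k + 1)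
  have hanti : T.singularValues (k + 1) ≤ T.singularValues k :=
    T.singularValues_antitone (Nat.le_succ k)
  have up : T.singularValues k ≤ 1 + δ := by
    have h1 := hup (v i)
    have h2 := H 1 0
    simp only [one_smul, zero_smul, add_zero, one_pow, one_mul, ne_eq, OfNat.ofNat_ne_zero,
      not_false_eq_true, zero_pow, zero_mul] at h2
    have h3 : ‖T (v i)‖ = T.singularValues k := by
      rwa [sq_eq_sq₀ (norm_nonneg _) s0] at h2
    rw [h3, v.orthonormal.1 i, mul_one] at h1
    exact h1
  -- a nonzero vector of the plane spanned by two consecutive singular vectors is orthogonal to `w`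
  obtain ⟨a, b, hab, hw⟩ : ∃ a b : ℝ, 0 < a ^ 2 + b ^ 2 ∧ inner ℝ w (a • v i + b • v j) = 0 := by
    by_cases h : inner ℝ w (v i) = 0
    · exact ⟨1, 0, by norm_num, by simp [h]⟩
    · refine ⟨inner ℝ w (v j), -inner ℝ w (v i), by rw [neg_sq]; positivity, ?_⟩
      rw [inner_add_right, inner_smul_right, inner_smul_right]
      ring
  have low : 1 - δ ≤ T.singularValues k := by
    have h1 := hlow _ hw
    by_contra! hlt
    have hpos : 0 < ‖a • v i + b • v j‖ := by
      have := N a b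
      by_contra! h
      have h0 : ‖a • v i + b • v j‖ = 0 := le_antisymm h (norm_nonneg _)
      rw [h0] at this
      simp at this
      linarith
    have h2 : ‖T (a • v i + b • v j)‖ ≤ T.singularValues k * ‖a • v i + b • v j‖ := by
      refine le_of_sq_le_sq ?_ (by positivity)
      rw [mul_pow, H, N]
      nlinarith [sq_nonneg b, pow_le_pow_left₀ s1 hanti 2]
    nlinarith
  rw [abs_le]
  constructor <;> linarith

/-! ### Bounding the operator norm by the Gram matrix of the rows -/

open scoped Matrix.Norms.L2Operator in
lemma Matrix.l2_opNorm_le_of_sum_sq_le {n : ℕ} (A : Matrix (Fin n) (Fin n) ℝ) {F : ℝ}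
    (hF : 0 ≤ F) (h : ∑ i, ∑ j, A i j ^ 2 ≤ F ^ 2) : ‖A‖ ≤ F := by
  rw [← Matrix.l2_opNorm_toEuclideanCLM]
  refine ContinuousLinearMap.opNorm_le_bound _ hF fun v => ?_
  refine le_of_sq_le_sq ?_ (by positivity)
  rw [mul_pow, EuclideanSpace.norm_sq_eq, EuclideanSpace.norm_sq_eq]
  simp only [Real.norm_eq_abs, sq_abs, Matrix.ofLp_toEuclideanCLM]
  calc ∑ i, (A.mulVec v.ofLp i) ^ 2
      ≤ ∑ i, (∑ j, A i j ^ 2) * ∑ j, v j ^ 2 :=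
        Finset.sum_le_sum fun i _ => Finset.sum_mul_sq_le_sq_mul_sq Finset.univ (A i) v.ofLp
    _ = (∑ i, ∑ j, A i j ^ 2) * ∑ j, v j ^ 2 := by rw [Finset.sum_mul]
    _ ≤ F ^ 2 * ∑ j, v j ^ 2 := by gcongr

open scoped Matrix.Norms.L2Operator in
/-- `‖A‖² = ‖A Aᵀ‖` is at most the Frobenius norm of `A Aᵀ`. -/
lemma Matrix.l2_opNorm_sq_le_of_gram {n : ℕ} (A : Matrix (Fin n) (Fin n) ℝ) {F : ℝ}
    (hF : 0 ≤ F) (h : ∑ i, ∑ j, (∑ k, A i k * A j k) ^ 2 ≤ F ^ 2) : ‖A‖ ^ 2 ≤ F := by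
  have h1 : ‖A * A.conjTranspose‖ ≤ F := by
    refine Matrix.l2_opNorm_le_of_sum_sq_le _ hF ?_
    simpa [Matrix.mul_apply] using h
  have h2 := Matrix.l2_opNorm_conjTranspose_mul_self A.conjTranspose
  rw [Matrix.conjTranspose_conjTranspose, Matrix.l2_opNorm_conjTranspose] at h2
  rw [pow_two, ← h2]
  exact h1

/-! ### Row-normalized arrays with small centred sums -/

/-- The array `x` fluctuates around `1` by at most `M` in each entry, and the row sums and the
inner products of distinct rows of `x - 1` show square-root cancellation up to powers of `M`. -/
structure IsRegularArray {n : ℕ} (M : ℝ) (x : Fin n → Fin n → ℝ) : Prop where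
  entry : ∀ i k, |x i k - 1| ≤ M
  rowSum : ∀ i, |∑ k, (x i k - 1)| ≤ √n * M
  inner : ∀ i j, i ≠ j → |∑ k, (x i k - 1) * (x j k - 1)| ≤ √n * M ^ 2

lemma IsRegularArray.half_le_sum {n : ℕ} {M : ℝ} {x : Fin n → Fin n → ℝ}
    (h : IsRegularArray M x) (hM : M ≤ √n / 2) (i : Fin n) : (n : ℝ) / 2 ≤ ∑ k, x i k := by
  have h1 := h.rowSum i
  rw [Finset.sum_sub_distrib] at h1
  simp only [Finset.sum_const, Finset.card_univ, Fintype.card_fin, nsmul_eq_mul, mul_one] at h1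
  have h2 : √(n : ℝ) * M ≤ n / 2 := by
    have := Real.mul_self_sqrt (Nat.cast_nonneg (α := ℝ) n)
    nlinarith [Real.sqrt_nonneg (n : ℝ)]
  linarith [(abs_le.mp h1).1]

/-- Subtracting the mean of the rows subtracts the product of the means from the covariance. -/
lemma sum_sub_mean_mul_sub_mean {n : ℕ} (hn : n ≠ 0) (u v : Fin n → ℝ) :
    ∑ k, (u k - (∑ l, u l) / n) * (v k - (∑ l, v l) / n) =
      ∑ k, u k * v k - (∑ l, u l) * (∑ l, v l) / n := by
  have hn' : (n : ℝ) ≠ 0 := by exact_mod_cast hn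
  set a := ∑ l, u l with ha
  set b := ∑ l, v l with hb
  have : ∀ k, (u k - a / n) * (v k - b / n) =
      u k * v k - u k * (b / n) - a / n * v k + a / n * (b / n) := fun k => by ring
  simp only [this, Finset.sum_add_distrib, Finset.sum_sub_distrib, ← Finset.sum_mul,
    ← Finset.mul_sum, ← ha, ← hb, Finset.sum_const, Finset.card_univ, Fintype.card_fin,
    nsmul_eq_mul]
  field_simp
  ring

/-- The fluctuation of the row-normalized array around its mean `1 / n`. -/
noncomputable def centredRowNormalize {n : ℕ} (x : Fin n → Fin n → ℝ) : Matrix (Fin n) (Fin n) ℝ :=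
  rowNormalize x - Matrix.of fun _ _ => (1 / n : ℝ)

lemma gram_centredRowNormalize {n : ℕ} (hn : n ≠ 0) {x : Fin n → Fin n → ℝ}
    (hx : ∀ i, ∑ k, x i k ≠ 0) (i j : Fin n) :
    ∑ k, centredRowNormalize x i k * centredRowNormalize x j k =
      (∑ k, (x i k - 1) * (x j k - 1) -
        (∑ k, (x i k - 1)) * (∑ k, (x j k - 1)) / n) / ((∑ k, x i k) * ∑ k, x j k) := by
  have hn' : (n : ℝ) ≠ 0 := by exact_mod_cast hn
  rw [← sum_sub_mean_mul_sub_mean hn, Finset.sum_div]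
  refine Finset.sum_congr rfl fun k _ => ?_
  have key : ∀ i k, centredRowNormalize x i k =
      (x i k - 1 - (∑ l, (x i l - 1)) / n) / ∑ l, x i l := by
    intro i k
    have := hx i
    simp only [centredRowNormalize, rowNormalize, Matrix.sub_apply, Matrix.of_apply,
      Finset.sum_sub_distrib, Finset.sum_const, Finset.card_univ, Fintype.card_fin, nsmul_eq_mul]
    field_simp
    ring
  rw [key, key, div_mul_div_comm]

open scoped Matrix.Norms.L2Operator in
lemma IsRegularArray.norm_centredRowNormalize_le {n : ℕ} (hn : n ≠ 0) {M : ℝ} (hM0 : 0 ≤ M)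
    {x : Fin n → Fin n → ℝ} (h : IsRegularArray M x) (hM : M ≤ √n / 2) :
    ‖centredRowNormalize x‖ ≤ 3 * M * (n : ℝ) ^ (-(1 / 4) : ℝ) := by
  have hn0 : (0 : ℝ) < n := by exact_mod_cast Nat.pos_of_ne_zero hn
  have hn1 : (1 : ℝ) ≤ n := by exact_mod_cast Nat.one_le_iff_ne_zero.mpr hn
  set r := √(n : ℝ) with hr
  have hrr : r ^ 2 = n := Real.sq_sqrt hn0.le
  have hr0 : 0 < r := Real.sqrt_pos.mpr hn0
  have hr1 : 1 ≤ r := Real.one_le_sqrt.mpr hn1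
  have hS := h.half_le_sum hM
  have hS0 : ∀ i, ∑ k, x i k ≠ 0 := fun i => ((half_pos hn0).trans_le (hS i)).ne'
  have hden : ∀ i j, (n : ℝ) ^ 2 / 4 ≤ (∑ k, x i k) * ∑ k, x j k := fun i j => by
    nlinarith [mul_le_mul (hS i) (hS j) (by positivity) (by linarith [hS i])]
  -- entries of the Gram matrix off the diagonal
  have hoff : ∀ i j, i ≠ j →
      (∑ k, centredRowNormalize x i k * centredRowNormalize x j k) ^ 2 ≤ 64 * M ^ 4 / n ^ 3 := by
    intro i j hij
    rw [gram_centredRowNormalize hn hS0]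
    have hnum : |∑ k, (x i k - 1) * (x j k - 1) -
        (∑ k, (x i k - 1)) * (∑ k, (x j k - 1)) / n| ≤ 2 * (r * M ^ 2) := by
      have h1 := h.inner i j hij
      have h2 : |(∑ k, (x i k - 1)) * (∑ k, (x j k - 1)) / n| ≤ r * M ^ 2 := by
        rw [abs_div, abs_mul, abs_of_pos hn0, div_le_iff₀ hn0]
        calc _ ≤ (r * M) * (r * M) :=
              mul_le_mul (h.rowSum i) (h.rowSum j) (abs_nonneg _) (by positivity)
          _ = 1 * M ^ 2 * n := by rw [← hrr]; ring
          _ ≤ _ := by gcongr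
      exact (abs_sub _ _).trans (by linarith)
    rw [div_pow, ← sq_abs]
    calc _ ≤ (2 * (r * M ^ 2)) ^ 2 / ((n : ℝ) ^ 2 / 4) ^ 2 := by
          gcongr
          exact hden i j
      _ = 64 * M ^ 4 / n ^ 3 := by
          rw [mul_pow, mul_pow, hrr]
          field_simp
          ring
  have hdiag : ∀ i,
      (∑ k, centredRowNormalize x i k * centredRowNormalize x i k) ^ 2 ≤ 16 * M ^ 4 / n ^ 2 := by
    intro i
    rw [gram_centredRowNormalize hn hS0]
    have hcs : (∑ k, (x i k - 1)) * (∑ k, (x i k - 1)) / n ≤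
        ∑ k, (x i k - 1) * (x i k - 1) := by
      rw [div_le_iff₀ hn0]
      have := sq_sum_le_card_mul_sum_sq (s := Finset.univ) (f := fun k => x i k - 1)
      simp only [Finset.card_univ, Fintype.card_fin] at this
      simp only [← pow_two]
      linarith
    have h0 : 0 ≤ (∑ k, (x i k - 1)) * (∑ k, (x i k - 1)) / n :=
      div_nonneg (mul_self_nonneg _) hn0.le
    have hsum : ∑ k, (x i k - 1) * (x i k - 1) ≤ n * M ^ 2 := by
      calc _ ≤ ∑ _k : Fin n, M ^ 2 := Finset.sum_le_sum fun k _ => by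
            rw [← pow_two, ← sq_abs]
            exact pow_le_pow_left₀ (abs_nonneg _) (h.entry i k) 2
        _ = _ := by simp
    rw [div_pow]
    calc _ ≤ ((n : ℝ) * M ^ 2) ^ 2 / ((n : ℝ) ^ 2 / 4) ^ 2 := by
          gcongr
          · linarith
          · exact hden i i
      _ = 16 * M ^ 4 / n ^ 2 := by
          field_simp
          ring
  have hF : ∑ i, ∑ j, (∑ k, centredRowNormalize x i k * centredRowNormalize x j k) ^ 2 ≤
      (9 * M ^ 2 / r) ^ 2 := by
    calc _ ≤ ∑ i : Fin n, ∑ j : Fin n,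
          (64 * M ^ 4 / (n : ℝ) ^ 3 + if i = j then 16 * M ^ 4 / (n : ℝ) ^ 2 else 0) := by
          refine Finset.sum_le_sum fun i _ => Finset.sum_le_sum fun j _ => ?_
          split_ifs with hij
          · subst hij
            have : 0 ≤ 64 * M ^ 4 / (n : ℝ) ^ 3 := by positivity
            linarith [hdiag i]
          · linarith [hoff i j hij]
      _ = 80 * M ^ 4 / n := by
          simp only [Finset.sum_add_distrib, Finset.sum_const, Finset.card_univ, Fintype.card_fin,
            nsmul_eq_mul, Finset.sum_ite_eq, Finset.mem_univ, if_true]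
          field_simp
          ring
      _ ≤ 81 * M ^ 4 / n := by gcongr; norm_num
      _ = _ := by rw [div_pow, hrr]; ring
  have hgram := Matrix.l2_opNorm_sq_le_of_gram _ (by positivity) hF
  refine le_of_sq_le_sq (hgram.trans_eq ?_) (by positivity)
  have : ((n : ℝ) ^ (-(1 / 4) : ℝ)) ^ 2 = r⁻¹ := by
    rw [← Real.rpow_natCast, ← Real.rpow_mul hn0.le, hr, Real.sqrt_eq_rpow, ← Real.rpow_neg hn0.le]
    norm_num
  rw [mul_pow, this]
  ring

/-! ### The moment generating function of a centred exponential variable -/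

lemma toReal_exponentialPDF_one_smul_exp (s : ℝ) :
    (fun x => (exponentialPDF 1 x).toReal • Real.exp (s * (x - 1))) =
      (Set.Ici 0).indicator fun x => Real.exp (-s) * Real.exp ((s - 1) * x) := by
  ext x
  rw [exponentialPDF_eq]
  by_cases hx : 0 ≤ x
  · rw [Set.indicator_of_mem (Set.mem_Ici.mpr hx), if_pos hx,
      ENNReal.toReal_ofReal (by positivity), ← Real.exp_add, smul_eq_mul, one_mul, ← Real.exp_add]
    ring_nf
  · rw [Set.indicator_of_notMem (by simpa using hx), if_neg hx]
    simp

lemma expMeasure_eq_withDensity (r : ℝ) :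
    expMeasure r = volume.withDensity (exponentialPDF r) := rfl

lemma measurable_exponentialPDF (r : ℝ) : Measurable (exponentialPDF r) :=
  (measurable_exponentialPDFReal r).ennreal_ofReal

lemma integrable_exp_mul_sub_one_expMeasure {s : ℝ} (hs : s < 1) :
    Integrable (fun x => Real.exp (s * (x - 1))) (expMeasure 1) := by
  rw [expMeasure_eq_withDensity, integrable_withDensity_iff_integrable_smul'
    (measurable_exponentialPDF 1) (ae_of_all _ fun _ => ENNReal.ofReal_lt_top),
    toReal_exponentialPDF_one_smul_exp, integrable_indicator_iff measurableSet_Ici,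
    integrableOn_Ici_iff_integrableOn_Ioi]
  exact (integrableOn_exp_mul_Ioi (by linarith) 0).const_mul _

lemma integral_exp_mul_sub_one_expMeasure {s : ℝ} (hs : s < 1) :
    ∫ x, Real.exp (s * (x - 1)) ∂(expMeasure 1) = Real.exp (-s) / (1 - s) := by
  rw [expMeasure_eq_withDensity, integral_withDensity_eq_integral_toReal_smul
    (measurable_exponentialPDF 1) (ae_of_all _ fun _ => ENNReal.ofReal_lt_top),
    toReal_exponentialPDF_one_smul_exp, integral_indicator measurableSet_Ici,
    integral_Ici_eq_integral_Ioi, integral_const_mul, integral_exp_mul_Ioi (by linarith)]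
  have : 1 - s ≠ 0 := by linarith
  have : s - 1 ≠ 0 := by linarith
  simp
  field_simp
  ring

lemma exp_neg_div_one_sub_le {s : ℝ} (hs : |s| ≤ 1 / 2) :
    Real.exp (-s) / (1 - s) ≤ Real.exp (2 * s ^ 2) := by
  have hpos : 0 < 1 - s := by linarith [(abs_le.mp hs).2]
  have h := Real.abs_log_sub_add_sum_range_le (x := s) (by linarith) 1
  simp only [Finset.sum_range_one, zero_add, pow_one, Nat.cast_zero, div_one] at h
  have h2 : |s| ^ (1 + 1) / (1 - |s|) ≤ 2 * s ^ 2 := by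
    rw [div_le_iff₀ (by linarith), show (1 + 1 : ℕ) = 2 from rfl, sq_abs]
    nlinarith [sq_nonneg s]
  have h3 : -s - 2 * s ^ 2 ≤ Real.log (1 - s) := by linarith [(abs_le.mp (h.trans h2)).1]
  rw [div_le_iff₀ hpos]
  calc Real.exp (-s) = Real.exp (2 * s ^ 2) * Real.exp (-s - 2 * s ^ 2) := by
        rw [← Real.exp_add]; ring_nf
    _ ≤ Real.exp (2 * s ^ 2) * (1 - s) := by
        gcongr
        rw [← Real.exp_log hpos]
        exact Real.exp_le_exp.mpr h3

section

variable {Ω : Type*} [MeasurableSpace Ω] {μ : Measure Ω}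

/-- The moment generating function of `X` is at most `exp (c s²)` on `|s| ≤ b`. Integrability is a
separate field, since `mgf` is `0` where the exponential is not integrable. -/
structure HasSubGammaMGF (X : Ω → ℝ) (c b : ℝ) (μ : Measure Ω) : Prop where
  integrable : ∀ s, |s| ≤ b → Integrable (fun ω => Real.exp (s * X ω)) μ
  mgf_le : ∀ s, |s| ≤ b → mgf X μ s ≤ Real.exp (c * s ^ 2)

lemma ProbabilityTheory.HasLaw.hasSubGammaMGF_sub_one {X : Ω → ℝ}
    (hX : HasLaw X (expMeasure 1) μ) : HasSubGammaMGF (fun ω => X ω - 1) 2 (1 / 2) μ where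
  integrable s hs := by
    have h := integrable_exp_mul_sub_one_expMeasure (s := s) (by linarith [(abs_le.mp hs).2])
    rw [← hX.map_eq] at h
    exact h.comp_aemeasurable hX.aemeasurable
  mgf_le s hs := by
    have h := integral_exp_mul_sub_one_expMeasure (s := s) (by linarith [(abs_le.mp hs).2])
    rw [← hX.map_eq, integral_map hX.aemeasurable (by fun_prop)] at h
    rw [mgf, h]
    exact exp_neg_div_one_sub_le hs

/-! ### Chernoff bounds -/

/-- Chernoff's bound for the modulus of a sum of independent variables. -/
lemma measureReal_abs_sum_ge_le {ι : Type*} [Fintype ι] [IsProbabilityMeasure μ]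
    {Z : ι → Ω → ℝ} (hZ : iIndepFun Z μ) (hmeas : ∀ i, AEMeasurable (Z i) μ) {c b t : ℝ}
    (hsub : ∀ i, HasSubGammaMGF (Z i) c b μ) (ht : 0 ≤ t) (htb : t ≤ b) (a : ℝ) :
    μ.real {ω | a ≤ |∑ i, Z i ω|} ≤
      2 * Real.exp (Fintype.card ι * (c * t ^ 2) - t * a) := by
  have hm : ∀ s, mgf (∑ i, Z i) μ s = ∏ i, mgf (Z i) μ s := fun s =>
    hZ.mgf_sum₀ hmeas Finset.univ
  have hint : ∀ s, |s| ≤ b → Integrable (fun ω => Real.exp (s * (∑ i, Z i) ω)) μ := by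
    intro s hs
    -- otherwise the moment generating function of the sum takes the junk value `0`
    by_contra h
    have h0 : 0 < ∏ i, mgf (Z i) μ s :=
      Finset.prod_pos fun i _ => mgf_pos ((hsub i).integrable s hs)
    rw [← hm s, mgf_undef h] at h0
    exact h0.false
  have hle : ∀ s, |s| ≤ b → mgf (∑ i, Z i) μ s ≤ Real.exp (Fintype.card ι * (c * s ^ 2)) := by
    intro s hs
    rw [hm s]
    calc _ ≤ ∏ _i : ι, Real.exp (c * s ^ 2) :=
          Finset.prod_le_prod (fun i _ => mgf_nonneg) fun i _ => (hsub i).mgf_le s hs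
      _ = _ := by rw [Finset.prod_const, Finset.card_univ, ← Real.exp_nat_mul]
  have h1 : |t| ≤ b := by rwa [abs_of_nonneg ht]
  have h2 : |-t| ≤ b := by rwa [abs_neg]
  have hp := measure_ge_le_exp_mul_mgf a ht (hint t h1)
  have hn := measure_le_le_exp_mul_mgf (-a) (neg_nonpos.mpr ht) (hint (-t) h2)
  have hsub : {ω | a ≤ |∑ i, Z i ω|} ⊆
      {ω | a ≤ (∑ i, Z i) ω} ∪ {ω | (∑ i, Z i) ω ≤ -a} := by
    intro ω hω
    simp only [Set.mem_union, Set.mem_ofPred_eq, Finset.sum_apply] at hω ⊢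
    rcases le_abs.mp hω with h | h
    · exact Or.inl h
    · exact Or.inr (by linarith)
  have e : ∀ A : ℝ, Real.exp (-t * a) * Real.exp A = Real.exp (A - t * a) := fun A => by
    rw [← Real.exp_add]; ring_nf
  calc _ ≤ _ := measureReal_mono hsub
    _ ≤ _ := measureReal_union_le _ _
    _ ≤ Real.exp (-t * a) * Real.exp (Fintype.card ι * (c * t ^ 2)) +
        Real.exp (-t * a) * Real.exp (Fintype.card ι * (c * t ^ 2)) := by
        refine add_le_add (hp.trans ?_) (hn.trans ?_)
        · gcongr
          exact hle t h1
        · rw [neg_neg, mul_neg, ← neg_mul]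
          gcongr
          simpa using hle (-t) h2
    _ = _ := by rw [e]; ring

/-- `u` cut off to `0` where it exceeds `M` in modulus. -/
noncomputable def cutoff (M u : ℝ) : ℝ := if |u| ≤ M then u else 0

lemma abs_cutoff_le {M : ℝ} (hM : 0 ≤ M) (u : ℝ) : |cutoff M u| ≤ M := by
  unfold cutoff
  split_ifs with h
  · exact h
  · simpa using hM

lemma cutoff_of_le {M u : ℝ} (h : |u| ≤ M) : cutoff M u = u := if_pos h

lemma measurable_cutoff (M : ℝ) : Measurable (cutoff M) :=
  Measurable.ite (measurableSet_le (by fun_prop) (by fun_prop)) measurable_id measurable_const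

/-- Multiplying by an independent variable bounded by `M` rescales the parameters: conditionally on
the bounded factor, the product is a rescaled copy of the other factor. -/
lemma HasSubGammaMGF.mul_of_bounded [IsProbabilityMeasure μ] {U V : Ω → ℝ} {c b M : ℝ}
    (hV : HasSubGammaMGF V c b μ) (hc : 0 ≤ c) (hM : 0 < M) (hUM : ∀ ω, |U ω| ≤ M)
    (hU : AEMeasurable U μ) (hVm : AEMeasurable V μ) (hind : IndepFun U V μ) :
    HasSubGammaMGF (fun ω => U ω * V ω) (c * M ^ 2) (b / M) μ := by
  have hbd : ∀ s, |s| ≤ b / M → ∀ u, |u| ≤ M → |s * u| ≤ b := by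
    intro s hs u hu
    rw [abs_mul]
    calc |s| * |u| ≤ b / M * M := mul_le_mul hs hu (abs_nonneg _) ((abs_nonneg s).trans hs)
      _ = b := by field_simp
  have hint : ∀ s, |s| ≤ b / M → Integrable (fun ω => Real.exp (s * (U ω * V ω))) μ := by
    intro s hs
    have hb : 0 ≤ b := by
      have := (abs_nonneg s).trans hs
      by_contra! h
      exact absurd this (not_le.mpr (div_neg_of_neg_of_pos h hM))
    refine ((hV.integrable b (abs_of_nonneg hb).le).add
      (hV.integrable (-b) (by rw [abs_neg, abs_of_nonneg hb]))).mono' (by fun_prop)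
      (ae_of_all _ fun ω => ?_)
    have h := hbd s hs _ (hUM ω)
    have h1 : s * (U ω * V ω) ≤ b * |V ω| := by
      calc s * (U ω * V ω) ≤ |s * (U ω * V ω)| := le_abs_self _
        _ = |s * U ω| * |V ω| := by rw [← mul_assoc, abs_mul]
        _ ≤ _ := by gcongr
    rw [Real.norm_of_nonneg (Real.exp_pos _).le]
    simp only [Pi.add_apply]
    rcases abs_cases (V ω) with ⟨h2, _⟩ | ⟨h2, _⟩ <;> rw [h2] at h1
    · linarith [Real.exp_le_exp.mpr h1, Real.exp_pos (-b * V ω)]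
    · rw [mul_neg, ← neg_mul] at h1
      linarith [Real.exp_le_exp.mpr h1, Real.exp_pos (b * V ω)]
  refine ⟨hint, fun s hs => ?_⟩
  have hprod := hind.map_prod_eq_prod_map_map hU hVm
  have := Measure.isProbabilityMeasure_map hU
  have := Measure.isProbabilityMeasure_map hVm
  have hF : Measurable fun p : ℝ × ℝ => Real.exp (s * (p.1 * p.2)) := by fun_prop
  have hFint : Integrable (fun p : ℝ × ℝ => Real.exp (s * (p.1 * p.2)))
      ((μ.map U).prod (μ.map V)) := by
    rw [← hprod, integrable_map_measure hF.aestronglyMeasurable (hU.prodMk hVm)]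
    exact hint s hs
  have hae : ∀ᵐ u ∂(μ.map U), |u| ≤ M :=
    (ae_map_iff hU (measurableSet_le (by fun_prop) (by fun_prop))).mpr (ae_of_all _ hUM)
  calc mgf (fun ω => U ω * V ω) μ s
      = ∫ p, Real.exp (s * (p.1 * p.2)) ∂((μ.map U).prod (μ.map V)) := by
        rw [← hprod, integral_map (hU.prodMk hVm) hF.aestronglyMeasurable, mgf]
    _ = ∫ u, ∫ v, Real.exp (s * (u * v)) ∂(μ.map V) ∂(μ.map U) := integral_prod _ hFint
    _ ≤ ∫ _u, Real.exp (c * M ^ 2 * s ^ 2) ∂(μ.map U) := by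
        refine integral_mono_ae hFint.integral_prod_left (integrable_const _) ?_
        filter_upwards [hae] with u hu
        have h1 : ∫ v, Real.exp (s * (u * v)) ∂(μ.map V) = mgf V μ (s * u) := by
          rw [integral_map hVm (by fun_prop), mgf]
          simp only [mul_assoc]
        rw [h1]
        refine (hV.mgf_le _ (hbd s hs u hu)).trans (Real.exp_le_exp.mpr ?_)
        rw [mul_pow, mul_assoc, mul_comm (s ^ 2)]
        have : u ^ 2 ≤ M ^ 2 := by
          rw [← sq_abs]
          exact pow_le_pow_left₀ (abs_nonneg _) hu 2
        gcongr
    _ = _ := by simp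

/-! ### Concentration for an array of exponential variables -/

/-- The tuples obtained by grouping independent variables are independent. -/
lemma ProbabilityTheory.iIndepFun.curry {ι κ : Type*} [Finite ι] [Finite κ] {X : ι → κ → Ω → ℝ}
    (hX : ∀ i k, AEMeasurable (X i k) μ)
    (h : iIndepFun (fun p : ι × κ => X p.1 p.2) μ) :
    iIndepFun (fun i ω k => X i k ω) μ := by
  have hp := h.isProbabilityMeasure
  have hprob : ∀ i k, IsProbabilityMeasure (μ.map (X i k)) := fun i k =>
    Measure.isProbabilityMeasure_map (hX i k)
  have hrow : ∀ i, μ.map (fun ω k => X i k ω) = Measure.infinitePi fun k => μ.map (X i k) := by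
    intro i
    have hi : iIndepFun (fun k => X i k) μ :=
      h.precomp (g := fun k => (i, k)) (Prod.mk_right_injective i)
    exact hi.map_fun_eq_infinitePi_map₀' (hX i)
  rw [iIndepFun_iff_map_fun_eq_infinitePi_map₀' fun i => aemeasurable_pi_iff.mpr (hX i)]
  simp only [hrow]
  have hjoint : μ.map (fun ω (p : ι × κ) => X p.1 p.2 ω) =
      Measure.infinitePi fun p : ι × κ => μ.map (X p.1 p.2) :=
    h.map_fun_eq_infinitePi_map₀' fun p => hX p.1 p.2
  rw [← Measure.infinitePi_map_curry (fun i k => μ.map (X i k)), ← hjoint]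
  exact (AEMeasurable.map_map_of_aemeasurable (MeasurableEquiv.curry ι κ ℝ).measurable.aemeasurable
    (aemeasurable_pi_iff.mpr fun p : ι × κ => hX p.1 p.2)).symm

variable {n : ℕ} {x : Fin n → Fin n → Ω → ℝ}

lemma IsIIDExpArray.aemeasurable_sub_one (hx : IsIIDExpArray μ x) (i k : Fin n) :
    AEMeasurable (fun ω => x i k ω - 1) μ := (hx.law i k).aemeasurable.sub_const 1

lemma IsIIDExpArray.measureReal_entry_le [IsProbabilityMeasure μ] (hx : IsIIDExpArray μ x)
    (M : ℝ) (i k : Fin n) :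
    μ.real {ω | M ≤ |x i k ω - 1|} ≤ 2 * Real.exp (2 - M / 2) := by
  have h := measureReal_abs_sum_ge_le (ι := Unit) (Z := fun _ ω => x i k ω - 1)
    (iIndepFun.of_subsingleton) (fun _ => hx.aemeasurable_sub_one i k)
    (fun _ => (hx.law i k).hasSubGammaMGF_sub_one) (t := 1 / 2) (by norm_num) le_rfl M
  simp only [Finset.univ_unique, Finset.sum_singleton, Fintype.card_unit] at h
  refine h.trans ?_
  gcongr
  norm_num
  linarith

lemma IsIIDExpArray.measureReal_rowSum_le [IsProbabilityMeasure μ] (hx : IsIIDExpArray μ x)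
    (hn : 4 ≤ n) {M : ℝ} (hM : 0 ≤ M) (i : Fin n) :
    μ.real {ω | √n * M ≤ |∑ k, (x i k ω - 1)|} ≤ 2 * Real.exp (2 - M / 2) := by
  have hr : 2 ≤ √(n : ℝ) := by
    apply Real.le_sqrt_of_sq_le
    norm_num
    exact_mod_cast hn
  have hrr : √(n : ℝ) ^ 2 = n := Real.sq_sqrt (Nat.cast_nonneg n)
  have hind : iIndepFun (fun k ω => x i k ω - 1) μ :=
    (hx.indep.precomp (g := fun k => (i, k)) (Prod.mk_right_injective i)).comp
      (fun _ u => u - 1) (fun _ => by fun_prop)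
  have h := measureReal_abs_sum_ge_le hind (fun k => hx.aemeasurable_sub_one i k)
    (fun k => (hx.law i k).hasSubGammaMGF_sub_one) (t := (√n)⁻¹) (by positivity)
    (by rw [one_div]; gcongr) (√n * M)
  refine h.trans ?_
  have e1 : (Fintype.card (Fin n) : ℝ) * (2 * (√n)⁻¹ ^ 2) = 2 := by
    rw [Fintype.card_fin, inv_pow, hrr]
    field_simp
  have e2 : (√(n : ℝ))⁻¹ * (√n * M) = M := by field_simp
  rw [e1, e2]
  gcongr
  linarith

/-- Off the event that some entry is large, the inner product of two rows agrees with one in which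
the first factor is cut off; the latter obeys a Chernoff bound, which the former does not since a
product of two exponential variables has no exponential moments. -/
lemma IsIIDExpArray.measureReal_inner_le [IsProbabilityMeasure μ] (hx : IsIIDExpArray μ x)
    (hn : 4 ≤ n) {M : ℝ} (hM : 0 < M) {i j : Fin n} (hij : i ≠ j) :
    μ.real {ω | √n * M ^ 2 ≤ |∑ k, cutoff M (x i k ω - 1) * (x j k ω - 1)|} ≤
      2 * Real.exp (2 - M / 2) := by
  have hr : 2 ≤ √(n : ℝ) := by
    apply Real.le_sqrt_of_sq_le
    norm_num
    exact_mod_cast hn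
  have hrr : √(n : ℝ) ^ 2 = n := Real.sq_sqrt (Nat.cast_nonneg n)
  have hcol : iIndepFun (fun k ω i => x i k ω) μ :=
    iIndepFun.curry (X := fun k i => x i k) (fun k i => (hx.law i k).aemeasurable)
      (hx.indep.precomp (g := Prod.swap) Prod.swap_injective)
  have hind : iIndepFun (fun k ω => cutoff M (x i k ω - 1) * (x j k ω - 1)) μ :=
    hcol.comp (fun _ u => cutoff M (u i - 1) * (u j - 1)) fun _ =>
      ((measurable_cutoff M).comp ((measurable_pi_apply i).sub_const 1)).mul
        ((measurable_pi_apply j).sub_const 1)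
  have hU : ∀ k, AEMeasurable (fun ω => cutoff M (x i k ω - 1)) μ := fun k =>
    (measurable_cutoff M).comp_aemeasurable (hx.aemeasurable_sub_one i k)
  have hsub : ∀ k, HasSubGammaMGF (fun ω => cutoff M (x i k ω - 1) * (x j k ω - 1))
      (2 * M ^ 2) (1 / 2 / M) μ := fun k =>
    (hx.law j k).hasSubGammaMGF_sub_one.mul_of_bounded (by norm_num) hM
      (fun ω => abs_cutoff_le hM.le _) (hU k) (hx.aemeasurable_sub_one j k)
      ((hx.indep.indepFun (i := (i, k)) (j := (j, k)) (by simpa using hij)).comp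
        ((measurable_cutoff M).comp (measurable_id.sub_const 1)) (measurable_id.sub_const 1))
  have h := measureReal_abs_sum_ge_le hind (fun k => (hU k).mul (hx.aemeasurable_sub_one j k))
    hsub (t := (√n)⁻¹ / M) (by positivity) (by rw [one_div]; gcongr) (√n * M ^ 2)
  refine h.trans ?_
  have e1 : (Fintype.card (Fin n) : ℝ) * (2 * M ^ 2 * ((√n)⁻¹ / M) ^ 2) = 2 := by
    rw [Fintype.card_fin, div_pow, inv_pow, hrr]
    field_simp
  have e2 : (√(n : ℝ))⁻¹ / M * (√n * M ^ 2) = M := by field_simp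
  rw [e1, e2]
  gcongr
  linarith

lemma IsIIDExpArray.measureReal_not_isRegularArray_le [IsProbabilityMeasure μ]
    (hx : IsIIDExpArray μ x) (hn : 4 ≤ n) {M : ℝ} (hM : 0 < M) :
    μ.real {ω | ¬ IsRegularArray M fun i k => x i k ω} ≤
      6 * n ^ 2 * Real.exp (2 - M / 2) := by
  set q := 2 * Real.exp (2 - M / 2) with hq
  have hq0 : 0 ≤ q := by positivity
  have hn1 : (1 : ℝ) ≤ n := by exact_mod_cast (by omega : 1 ≤ n)
  set A := ⋃ i, ⋃ k, {ω | M ≤ |x i k ω - 1|} with hA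
  set B := ⋃ i, {ω | √n * M ≤ |∑ k, (x i k ω - 1)|} with hB
  set C := ⋃ i, ⋃ j, {ω | i ≠ j ∧
    √n * M ^ 2 ≤ |∑ k, cutoff M (x i k ω - 1) * (x j k ω - 1)|} with hC
  have hsub : {ω | ¬ IsRegularArray M fun i k => x i k ω} ⊆ A ∪ B ∪ C := by
    intro ω hω
    by_contra hcon
    simp only [hA, hB, hC, Set.mem_union, Set.mem_iUnion, Set.mem_ofPred_eq, not_or, not_exists,
      not_and, not_le] at hcon
    obtain ⟨⟨h1, h2⟩, h3⟩ := hcon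
    refine hω ⟨fun i k => (h1 i k).le, fun i => (h2 i).le, fun i j hij => ?_⟩
    have := (h3 i j hij).le
    simpa only [cutoff_of_le (h1 i _).le] using this
  have card : ∀ f : Fin n → ℝ, ∀ b : ℝ, (∀ i, f i ≤ b) → ∑ i, f i ≤ n * b := fun f b h => by
    simpa using Finset.sum_le_sum fun i (_ : i ∈ Finset.univ) => h i
  have bA : μ.real A ≤ n * (n * q) :=
    (measureReal_iUnion_fintype_le _).trans <| card _ _ fun i =>
      (measureReal_iUnion_fintype_le _).trans <| card _ _ fun k => hx.measureReal_entry_le M i k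
  have bB : μ.real B ≤ n * q :=
    (measureReal_iUnion_fintype_le _).trans <| card _ _ fun i =>
      hx.measureReal_rowSum_le hn hM.le i
  have bC : μ.real C ≤ n * (n * q) := by
    refine (measureReal_iUnion_fintype_le _).trans <| card _ _ fun i =>
      (measureReal_iUnion_fintype_le _).trans <| card _ _ fun j => ?_
    by_cases hij : i = j
    · simpa [hij] using hq0
    · simpa [hij] using hx.measureReal_inner_le hn hM hij
  calc _ ≤ μ.real (A ∪ B ∪ C) := measureReal_mono hsub
    _ ≤ μ.real A + μ.real B + μ.real C :=
      (measureReal_union_le _ _).trans (add_le_add_left (measureReal_union_le _ _) _)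
    _ ≤ n * (n * q) + n * (n * q) + n * (n * q) := by
      have : (n : ℝ) * q ≤ n * (n * q) := by
        gcongr
        exact le_mul_of_one_le_left hq0 hn1
      linarith
    _ = _ := by rw [hq]; ring

lemma ae_pos_expMeasure_one : ∀ᵐ u ∂(expMeasure 1), 0 < u := by
  rw [ae_iff]
  have : {u : ℝ | ¬ 0 < u} = Set.Iic 0 := by ext; simp
  rw [this, expMeasure_eq_withDensity, withDensity_apply _ measurableSet_Iic,
    setLIntegral_congr Iio_ae_eq_Iic.symm, lintegral_exponentialPDF_of_nonpos le_rfl]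

lemma IsIIDExpArray.ae_sum_pos (hx : IsIIDExpArray μ x) (hn : 1 ≤ n) :
    ∀ᵐ ω ∂μ, ∀ i, 0 < ∑ k, x i k ω := by
  have h : ∀ᵐ ω ∂μ, ∀ i k, 0 < x i k ω := ae_all_iff.mpr fun i => ae_all_iff.mpr fun k =>
    ((hx.law i k).ae_iff (p := fun u => 0 < u) (by fun_prop)).mpr ae_pos_expMeasure_one
  filter_upwards [h] with ω hω i
  exact Finset.sum_pos (fun k _ => hω i k) ⟨⟨0, by omega⟩, Finset.mem_univ _⟩

end

/-! ### Singular values and rank of `rowNormalize x - 1` -/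

lemma Matrix.rank_eq_finrank_range_toEuclideanLin {n : ℕ} (A : Matrix (Fin n) (Fin n) ℝ) :
    A.rank = Module.finrank ℝ (Matrix.toEuclideanLin A).range := by
  rw [Matrix.toEuclideanLin_eq_toLin_orthonormal]
  exact Matrix.rank_eq_finrank_range_toLin A _ _

/-- The constant vector is in the kernel. -/
lemma sv_rowNormalize_sub_one_eq_zero {n : ℕ} (hn : 1 ≤ n) {x : Fin n → Fin n → ℝ}
    (hx : ∀ i, 0 < ∑ k, x i k) : sv (rowNormalize x - 1) n = 0 := by
  set T := Matrix.toEuclideanLin (rowNormalize x - 1) with hT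
  have hker : T (WithLp.toLp 2 fun _ => 1) = 0 := by
    ext i
    simp only [hT, Matrix.ofLp_toLpLin, Matrix.toLin'_apply, Matrix.sub_mulVec, Matrix.one_mulVec,
      Pi.sub_apply, PiLp.zero_apply]
    simp only [Matrix.mulVec, dotProduct, rowNormalize, Matrix.of_apply, mul_one]
    rw [← Finset.sum_div, div_self (hx i).ne', sub_self]
  have hinj : ¬ Function.Injective T := fun h => by
    have h0 := h (hker.trans (map_zero T).symm)
    have := congrArg (fun v => v.ofLp ⟨0, hn⟩) h0
    simp at this
  rw [T.injective_iff_forall_lt_finrank_singularValues_pos] at hinj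
  push Not at hinj
  obtain ⟨i, hi, hi0⟩ := hinj
  rw [finrank_euclideanSpace_fin] at hi
  exact le_antisymm ((T.singularValues_antitone (by omega : i ≤ n - 1)).trans hi0)
    (T.singularValues_nonneg _)

/-- Subtracting the mean is an orthogonal projection. -/
lemma norm_sub_mean_le {n : ℕ} (v : EuclideanSpace ℝ (Fin n)) :
    ‖v - WithLp.toLp 2 (fun _ => (∑ k, v k) / n)‖ ≤ ‖v‖ := by
  rcases eq_or_ne n 0 with rfl | hn
  · rw [Subsingleton.elim (v - _) v]
  refine le_of_sq_le_sq ?_ (norm_nonneg _)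
  have h := sum_sub_mean_mul_sub_mean hn v.ofLp v.ofLp
  rw [EuclideanSpace.norm_sq_eq, EuclideanSpace.norm_sq_eq]
  simp only [Real.norm_eq_abs, pow_two, abs_mul_abs_self, PiLp.sub_apply, h]
  have : 0 ≤ (∑ k, v k) * (∑ k, v k) / (n : ℝ) :=
    div_nonneg (mul_self_nonneg _) (Nat.cast_nonneg n)
  linarith

open scoped Matrix.Norms.L2Operator in
/-- `rowNormalize x - 1` differs by `centredRowNormalize x` from minus the orthogonal projection to
the complement of the constant vectors. -/
lemma abs_sv_rowNormalize_sub_one_sub_one_le {n : ℕ} (x : Fin n → Fin n → ℝ) {j : ℕ} (hj1 : 1 ≤ j)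
    (hj : j ≤ n - 1) : |sv (rowNormalize x - 1) j - 1| ≤ ‖centredRowNormalize x‖ := by
  set E := centredRowNormalize x with hE
  have hEv : ∀ v : EuclideanSpace ℝ (Fin n), ‖Matrix.toEuclideanLin E v‖ ≤ ‖E‖ * ‖v‖ := fun v =>
    E.l2_opNorm_mulVec v
  have hdec : ∀ v : EuclideanSpace ℝ (Fin n), Matrix.toEuclideanLin (rowNormalize x - 1) v =
      Matrix.toEuclideanLin E v - (v - WithLp.toLp 2 (fun _ => (∑ k, v k) / n)) := by
    intro v
    ext i
    simp only [hE, centredRowNormalize, Matrix.ofLp_toLpLin, Matrix.toLin'_apply,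
      Matrix.sub_mulVec, Matrix.one_mulVec, Pi.sub_apply, PiLp.sub_apply]
    have : (Matrix.of fun _ _ => (1 / n : ℝ) : Matrix (Fin n) (Fin n) ℝ).mulVec v.ofLp i =
        (∑ k, v k) / n := by
      simp only [Matrix.mulVec, dotProduct, Matrix.of_apply, ← Finset.mul_sum]
      ring
    rw [this]
    ring
  refine abs_singularValues_sub_one_le _ (WithLp.toLp 2 fun _ => 1) (fun v => ?_) (fun v hv => ?_)
    (by rw [finrank_euclideanSpace_fin]; omega)
  · rw [hdec]
    calc _ ≤ _ := norm_sub_le _ _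
      _ ≤ ‖E‖ * ‖v‖ + ‖v‖ := add_le_add (hEv v) (norm_sub_mean_le v)
      _ = _ := by ring
  · have hsum : ∑ k, v k = 0 := by
      simpa [PiLp.inner_apply] using hv
    have h0 : v - WithLp.toLp 2 (fun _ : Fin n => (∑ k, v k) / (n : ℝ)) = v := by
      ext i
      simp [hsum]
    rw [hdec, h0, norm_sub_rev]
    have := norm_sub_norm_le v (Matrix.toEuclideanLin E v)
    linarith [hEv v]

open scoped Matrix.Norms.L2Operator in
lemma rank_rowNormalize_sub_one {n : ℕ} (hn : 2 ≤ n) {x : Fin n → Fin n → ℝ}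
    (hx : ∀ i, 0 < ∑ k, x i k) (hE : ‖centredRowNormalize x‖ < 1) :
    (rowNormalize x - 1).rank = n - 1 := by
  rw [Matrix.rank_eq_finrank_range_toEuclideanLin]
  have h1 := sv_rowNormalize_sub_one_eq_zero (by omega) hx
  have h2 := abs_sv_rowNormalize_sub_one_sub_one_le x (j := n - 1) (by omega) le_rfl
  have h3 : 0 < sv (rowNormalize x - 1) (n - 1) := by
    linarith [(abs_le.mp h2).1]
  have h4 := (LinearMap.singularValues_eq_zero_iff_le_finrank_range _).mp h1
  have h5 := (LinearMap.singularValues_pos_iff_lt_finrank_range _).mp h3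
  omega

/-! ### Stretched-exponential tails beat powers -/

open Filter in
lemma eventually_sq_mul_exp_le_rpow_neg {η : ℝ} (hη : 0 < η) (D : ℝ) :
    ∀ᶠ n : ℕ in atTop, 6 * (n : ℝ) ^ 2 * Real.exp (2 - (n : ℝ) ^ η / 2) ≤ (n : ℝ) ^ (-D) := by
  have h1 := (tendsto_rpow_mul_exp_neg_mul_atTop_nhds_zero ((D + 2) / η) (1 / 2)
    (by norm_num)).comp ((tendsto_rpow_atTop hη).comp tendsto_natCast_atTop_atTop)
  have h2 : ∀ᶠ n : ℕ in atTop, ((n : ℝ) ^ η) ^ ((D + 2) / η) *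
      Real.exp (-(1 / 2) * (n : ℝ) ^ η) < (6 * Real.exp 2)⁻¹ :=
    h1.eventually_lt_const (by positivity)
  filter_upwards [h2, eventually_gt_atTop 0] with n hn hn0
  have hn0' : (0 : ℝ) < n := by exact_mod_cast hn0
  rw [← Real.rpow_mul hn0'.le, mul_div_cancel₀ _ hη.ne', Real.rpow_add hn0', Real.rpow_two] at hn
  rw [Real.rpow_neg hn0'.le, sub_eq_add_neg, Real.exp_add]
  have e : -((n : ℝ) ^ η / 2) = -(1 / 2) * (n : ℝ) ^ η := by ring
  rw [e, ← one_div, le_div_iff₀ (by positivity)]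
  have h3 := mul_lt_mul_of_pos_left hn (show 0 < 6 * Real.exp 2 by positivity)
  rw [mul_inv_cancel₀ (by positivity)] at h3
  refine le_trans (le_of_eq ?_) h3.le
  ring

open Filter in
open scoped Matrix.Norms.L2Operator in
/-- With overwhelming probability all row sums are positive and the centred matrix has operator norm
at most `n ^ (ε - 1 / 4)`. -/
lemma eventually_measureReal_not_le {Ω : ℕ → Type*} [∀ n, MeasurableSpace (Ω n)]
    (μ : ∀ n, Measure (Ω n)) [∀ n, IsProbabilityMeasure (μ n)]
    (x : ∀ n, Fin n → Fin n → Ω n → ℝ) (hx : ∀ n, IsIIDExpArray (μ n) (x n))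
    {ε : ℝ} (hε : 0 < ε) (D : ℝ) :
    ∀ᶠ n in atTop, (μ n).real {ω | ¬ ((∀ i, 0 < ∑ k, x n i k ω) ∧
      ‖centredRowNormalize fun i k => x n i k ω‖ ≤ (n : ℝ) ^ ε * (n : ℝ) ^ (-(1 / 4) : ℝ))} ≤
      (n : ℝ) ^ (-D) := by
  -- `η < ε` absorbs constants, and `η < 1 / 2` keeps the row sums comparable to `n`
  set η := min ε (1 / 2) / 2 with hη
  have hmin : 0 < min ε (1 / 2) := lt_min hε (by norm_num)
  have hη0 : 0 < η := half_pos hmin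
  have hηε : 0 < ε - η := by linarith [min_le_left ε (1 / 2)]
  have hη2 : 0 < 1 / 2 - η := by linarith [min_le_right ε (1 / 2)]
  have t1 := ((tendsto_rpow_atTop hηε).comp tendsto_natCast_atTop_atTop).eventually_ge_atTop 3
  have t2 := ((tendsto_rpow_atTop hη2).comp tendsto_natCast_atTop_atTop).eventually_ge_atTop 2
  filter_upwards [eventually_sq_mul_exp_le_rpow_neg hη0 D, t1, t2, eventually_ge_atTop 4]
    with n h0 h1 h2 h4
  simp only [Function.comp_apply] at h1 h2
  have hn0 : (0 : ℝ) < n := by exact_mod_cast (by omega : 0 < n)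
  have hM : 0 < (n : ℝ) ^ η := by positivity
  refine le_trans (measureReal_mono ?_)
    (((hx n).measureReal_not_isRegularArray_le h4 hM).trans h0)
  intro ω hω hreg
  have hMs : (n : ℝ) ^ η ≤ √n / 2 := by
    have : (n : ℝ) ^ (1 / 2 - η) * (n : ℝ) ^ η = √n := by
      rw [← Real.rpow_add hn0, sub_add_cancel, Real.sqrt_eq_rpow]
    nlinarith
  refine hω ⟨fun i => (half_pos hn0).trans_le (hreg.half_le_sum hMs i), ?_⟩
  refine (hreg.norm_centredRowNormalize_le (by omega) hM.le hMs).trans ?_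
  gcongr
  have : (n : ℝ) ^ (ε - η) * (n : ℝ) ^ η = (n : ℝ) ^ ε := by
    rw [← Real.rpow_add hn0, sub_add_cancel]
  nlinarith

theorem mainTheorem2 {Ω : ℕ → Type*} [∀ n, MeasurableSpace (Ω n)]
    (μ : ∀ n, Measure (Ω n)) [∀ n, IsProbabilityMeasure (μ n)]
    (x : ∀ n, Fin n → Fin n → Ω n → ℝ) (hx : ∀ n, IsIIDExpArray (μ n) (x n))
    (W : ∀ n, Ω n → Matrix (Fin n) (Fin n) ℝ)
    (hW : ∀ n ω, W n ω = rowNormalize (fun i j => x n i j ω) - 1) :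
    (∀ n, 1 ≤ n → ∀ᵐ ω ∂(μ n), sv (W n ω) n = 0) ∧
    StochDomUnif μ (V := fun n => {j : ℕ // 1 ≤ j ∧ j ≤ n - 1})
      (fun n j ω => |sv (W n ω) j - 1|) (fun n _ _ => (n : ℝ) ^ (-(1 / 4) : ℝ)) ∧
    WithHighProb μ (fun n => {ω | (W n ω).rank = n - 1}) := by
  simp only [hW]
  refine ⟨fun n hn => ?_, fun ε hε D _ => ?_, fun D _ => ?_⟩
  · filter_upwards [(hx n).ae_sum_pos hn] with ω hω
    exact sv_rowNormalize_sub_one_eq_zero hn hω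
  · obtain ⟨N, hN⟩ := Filter.eventually_atTop.mp (eventually_measureReal_not_le μ x hx hε D)
    refine ⟨N, fun n hn j => (measureReal_mono fun ω hω hgood => ?_).trans (hN n hn.le)⟩
    exact absurd ((abs_sv_rowNormalize_sub_one_sub_one_le _ j.2.1 j.2.2).trans hgood.2)
      (not_le.mpr hω)
  · obtain ⟨N, hN⟩ := Filter.eventually_atTop.mp
      (eventually_measureReal_not_le μ x hx (ε := 1 / 8) (by norm_num) D)
    refine ⟨max N 2, fun n hn => ?_⟩
    have hn2 : 2 ≤ n := (le_max_right _ _).trans hn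
    have hn1 : (1 : ℝ) < n := by exact_mod_cast hn2
    have hlt : (n : ℝ) ^ (1 / 8 : ℝ) * (n : ℝ) ^ (-(1 / 4) : ℝ) < 1 := by
      rw [← Real.rpow_add (by linarith)]
      exact Real.rpow_lt_one_of_one_lt_of_neg hn1 (by norm_num)
    have hbad := hN n ((le_max_left _ _).trans hn)
    set R := {ω | (rowNormalize (fun i j => x n i j ω) - 1).rank = n - 1}
    have hc : (μ n).real Rᶜ ≤ (n : ℝ) ^ (-D) := by
      refine le_trans (measureReal_mono ?_) hbad
      intro ω hω hgood
      exact hω (rank_rowNormalize_sub_one hn2 hgood.1 (hgood.2.trans_lt hlt))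
    -- subadditivity only: no measurability of the rank event is needed
    have hu : 1 ≤ (μ n).real R + (μ n).real Rᶜ := by
      rw [← probReal_univ (μ := μ n), ← Set.union_compl_self R]
      exact measureReal_union_le _ _
    linarith
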